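/- Let $M$ be a $4n$-dimensional smooth (Hausdorff) manifold. Let $J_1,J_2,J_3$ be smooth almost complex structures on $M$ with $J_\alpha^2=-\mathrm{Id}$ and $J_\alpha=J_\beta J_\gamma=-J_\gamma J_\beta$ for all cyclic permutations $(\alpha,\beta,\gamma)$ of $(1,2,3)$. Let $g$ be a pseudo-Riemannian metric with $g(x,y)=\varepsilon_\alpha g(J_\alpha x,J_\alpha y)$, where $\varepsilon_1=1$, $\varepsilon_2=\varepsilon_3=-1$. Let $\nabla$ be the Levi-Civita connection of $g$ and put $F_\alpha(x,y,z)=g\bigl((\nabla_xJ_\alpha)y,z\bigr)$. Suppose that $M$ belongs to the class $\mathcal W_{133}$, that is, $$F_1(x,y,z)=-F_1(y,x,z),\qquad F_\alpha(x,y,z)+F_\alpha(y,z,x)+F_\alpha(z,x,y)=0\quad(\alpha=2,3)$$ for all tangent vectors $x,y,z$. Let $D$ be the pHKT-connection, i.e. a linear connection with $Dg=0$ and $DJ_1=DJ_2=DJ_3=0$ whose torsion $T(x,y)=D_xy-D_yx-[x,y]$ is totally skew-symmetric, which means that $T(x,y,z)=g(T(x,y),z)$ is a $3$-form. If $D$ is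 flat (its curvature tensor vanishes) or strong ($\mathrm dT=0$), then: 1. $\nabla$ is flat (its curvature tensor vanishes); 2. $M$ is isotropic-hyper-Kählerian: $\|\nabla J_\alpha\|^2=0$ for $\alpha=1,2,3$; 3. the torsion of $D$ is isotropic: $\|T\|^2=0$. Here, at every point and for every basis $(e_i)$ of the tangent space, with $(g^{ij})$ the inverse of the matrix $(g(e_i,e_j))$ and with summation over repeated indices, $$\|\nabla J_\alpha\|^2=g^{ij}g^{ks}\,g\bigl((\nabla_{e_i}J_\alpha)e_k,(\nabla_{e_j}J_\alpha)e_s\bigr),\qquad \|T\|^2=g^{ij}g^{ks}\,g\bigl(T(e_i,e_k),T(e_j,e_s)\bigr).$$ -/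

import Mathlib

open scoped Manifold ContDiff

noncomputable section

namespace PHKT

variable {E : Type*} [NormedAddCommGroup E] [NormedSpace ℝ E]
  {M : Type*} [TopologicalSpace M] [ChartedSpace E M]

/-- A (not necessarily smooth) vector field on `M`. -/
abbrev VField (E : Type*) [NormedAddCommGroup E] [NormedSpace ℝ E]
    (M : Type*) [TopologicalSpace M] [ChartedSpace E M] : Type _ :=
  (x : M) → TangentSpace 𝓘(ℝ, E) x

/-- A linear connection on the tangent bundle of `M`. Recall that `D Y x v` is `(D_v Y)(x)`. Its
smoothness is a separate condition, `ContMDiffCovariantDerivative D ∞`. -/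
abbrev Connection (E : Type*) [NormedAddCommGroup E] [NormedSpace ℝ E]
    (M : Type*) [TopologicalSpace M] [ChartedSpace E M] [IsManifold 𝓘(ℝ, E) ∞ M] : Type _ :=
  CovariantDerivative 𝓘(ℝ, E) E (TangentSpace 𝓘(ℝ, E) : M → Type _)

variable [IsManifold 𝓘(ℝ, E) ∞ M]

/-- The vector field `X` is smooth, that is, `X ∈ 𝔛(M)`. -/
def IsSmooth (X : VField E M) : Prop :=
  ContMDiff 𝓘(ℝ, E) (𝓘(ℝ, E).prod 𝓘(ℝ, E)) ∞
    (fun x => Bundle.TotalSpace.mk' E (E := (TangentSpace 𝓘(ℝ, E) : M → Type _)) x (X x))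

/-- A pseudo-Riemannian metric: a smooth field of nondegenerate symmetric bilinear forms. -/
structure PseudoMetric (E : Type*) [NormedAddCommGroup E] [NormedSpace ℝ E]
    (M : Type*) [TopologicalSpace M] [ChartedSpace E M] [IsManifold 𝓘(ℝ, E) ∞ M] where
  /-- The bilinear form on each tangent space. -/
  val (x : M) : TangentSpace 𝓘(ℝ, E) x →L[ℝ] TangentSpace 𝓘(ℝ, E) x →L[ℝ] ℝ
  symm (x : M) (v w : TangentSpace 𝓘(ℝ, E) x) : val x v w = val x w v
  nondegenerate (x : M) (v : TangentSpace 𝓘(ℝ, E) x) (hv : ∀ w, val x v w = 0) : v = 0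
  contMDiff : ContMDiff 𝓘(ℝ, E) (𝓘(ℝ, E).prod 𝓘(ℝ, E →L[ℝ] E →L[ℝ] ℝ)) ∞
    (fun x => Bundle.TotalSpace.mk' (E →L[ℝ] E →L[ℝ] ℝ)
      (E := fun x : M => TangentSpace 𝓘(ℝ, E) x →L[ℝ] TangentSpace 𝓘(ℝ, E) x →L[ℝ] ℝ) x (val x))

/-- A smooth field of endomorphisms of the tangent spaces. -/
structure EndField (E : Type*) [NormedAddCommGroup E] [NormedSpace ℝ E]
    (M : Type*) [TopologicalSpace M] [ChartedSpace E M] [IsManifold 𝓘(ℝ, E) ∞ M] where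
  /-- The endomorphism of each tangent space. -/
  val (x : M) : TangentSpace 𝓘(ℝ, E) x →L[ℝ] TangentSpace 𝓘(ℝ, E) x
  contMDiff : ContMDiff 𝓘(ℝ, E) (𝓘(ℝ, E).prod 𝓘(ℝ, E →L[ℝ] E)) ∞
    (fun x => Bundle.TotalSpace.mk' (E →L[ℝ] E)
      (E := fun x : M => TangentSpace 𝓘(ℝ, E) x →L[ℝ] TangentSpace 𝓘(ℝ, E) x) x (val x))

/-- `Y ↦ (D J) Y = D (J Y) - J (D Y)` is tensorial in `Y`. -/
theorem EndField.tensorialAt_covDeriv (J : EndField E M) (D : Connection E M) (x : M) :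
    TensorialAt 𝓘(ℝ, E) E
      (fun Y : VField E M => D (fun p => J.val p (Y p)) x - (J.val x).comp (D Y x)) x := by
  have hJ : ∀ {Y : VField E M}, MDiffAt (T% Y) x → MDiffAt (T% (fun p => J.val p (Y p))) x := by
    intro Y hY
    exact MDifferentiableAt.clm_bundle_apply (F₁ := E) (F₂ := E)
      ((J.contMDiff x).mdifferentiableAt (by simp)) hY
  constructor
  · intro f Y hf hY
    have h1 : (fun p => J.val p ((f • Y) p)) = f • (fun p => J.val p (Y p)) := by
      funext p; simp
    rw [h1, D.isCovariantDerivativeOn.leibniz (s := Set.univ) (hJ hY) hf,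
      D.isCovariantDerivativeOn.leibniz (s := Set.univ) hY hf]
    ext v
    simp
    module
  · intro Y Y' hY hY'
    have h1 : (fun p => J.val p ((Y + Y') p))
        = (fun p => J.val p (Y p)) + (fun p => J.val p (Y' p)) := by
      funext p; simp
    rw [h1, D.isCovariantDerivativeOn.add (s := Set.univ) (hJ hY) (hJ hY'),
      D.isCovariantDerivativeOn.add (s := Set.univ) hY hY']
    ext v
    simp
    module

/-- The Lie derivative of the function `f` along `v`, `v(f)`. -/
def dirDeriv (f : M → ℝ) (x : M) (v : TangentSpace 𝓘(ℝ, E) x) : ℝ :=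
  mvfderiv 𝓘(ℝ, E) f x v

/-- `D g = 0`: `v(g(Y, Z)) = g(D_v Y, Z) + g(Y, D_v Z)`. -/
def PseudoMetric.IsParallel (g : PseudoMetric E M) (D : Connection E M) : Prop :=
  ∀ (Y Z : VField E M), IsSmooth Y → IsSmooth Z → ∀ (x : M) (v : TangentSpace 𝓘(ℝ, E) x),
    dirDeriv (fun p => g.val p (Y p) (Z p)) x v
      = g.val x (D Y x v) (Z x) + g.val x (Y x) (D Z x v)

/-- The curvature `R(X, Y) Z = D_X D_Y Z - D_Y D_X Z - D_[X,Y] Z` of `D`. -/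
def curvature (D : Connection E M) (X Y Z : VField E M) : VField E M := fun x =>
  D (fun p => D Z p (Y p)) x (X x) - D (fun p => D Z p (X p)) x (Y x)
    - D Z x (VectorField.mlieBracket 𝓘(ℝ, E) X Y x)

/-- `D` is flat: its curvature tensor vanishes. -/
def IsFlat (D : Connection E M) : Prop :=
  ∀ X Y Z : VField E M, IsSmooth X → IsSmooth Y → IsSmooth Z → ∀ x, curvature D X Y Z x = 0

/-- The exterior derivative of a 3-form `τ` on vector fields, up to the normalisation factor
that some authors use. -/
def extDeriv₃ (τ : (x : M) → TangentSpace 𝓘(ℝ, E) x → TangentSpace 𝓘(ℝ, E) x →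
    TangentSpace 𝓘(ℝ, E) x → ℝ) (X Y Z W : VField E M) (x : M) : ℝ :=
  dirDeriv (fun p => τ p (Y p) (Z p) (W p)) x (X x)
  - dirDeriv (fun p => τ p (X p) (Z p) (W p)) x (Y x)
  + dirDeriv (fun p => τ p (X p) (Y p) (W p)) x (Z x)
  - dirDeriv (fun p => τ p (X p) (Y p) (Z p)) x (W x)
  - τ x (VectorField.mlieBracket 𝓘(ℝ, E) X Y x) (Z x) (W x)
  + τ x (VectorField.mlieBracket 𝓘(ℝ, E) X Z x) (Y x) (W x)
  - τ x (VectorField.mlieBracket 𝓘(ℝ, E) X W x) (Y x) (Z x)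
  - τ x (VectorField.mlieBracket 𝓘(ℝ, E) Y Z x) (X x) (W x)
  + τ x (VectorField.mlieBracket 𝓘(ℝ, E) Y W x) (X x) (Z x)
  - τ x (VectorField.mlieBracket 𝓘(ℝ, E) Z W x) (X x) (Y x)

/-- The square norm `g^{ij} g^{ks} g(B(e_i, e_k), B(e_j, e_s))` of a `TM`-valued bilinear map `B`
on a tangent space with respect to the basis `e`; it does not depend on the basis. -/
def PseudoMetric.sqNorm (g : PseudoMetric E M) {x : M} {ι : Type*} [Fintype ι] [DecidableEq ι]
    (e : Module.Basis ι ℝ (TangentSpace 𝓘(ℝ, E) x))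
    (B : TangentSpace 𝓘(ℝ, E) x → TangentSpace 𝓘(ℝ, E) x → TangentSpace 𝓘(ℝ, E) x) : ℝ :=
  let G : Matrix ι ι ℝ := Matrix.of fun i j => g.val x (e i) (e j)
  ∑ i, ∑ j, ∑ k, ∑ s, G⁻¹ i j * G⁻¹ k s * g.val x (B (e i) (e k)) (B (e j) (e s))

/-- The signs `ε₁ = 1`, `ε₂ = ε₃ = -1`; the index `α = 1, 2, 3` is written as `0, 1, 2 : Fin 3`. -/
def eps (α : Fin 3) : ℝ := if α = 0 then 1 else -1

/-- An almost `(H,G)`-structure: an almost hypercomplex structure `(J₁, J₂, J₃)` together with a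
pseudo-Riemannian metric `g` that is Hermitian for `J₁` and anti-Hermitian (Norden) for
`J₂`, `J₃`. The triples `(α, α + 1, α + 2)` are the cyclic permutations. -/
structure AlmostHGStructure (E : Type*) [NormedAddCommGroup E] [NormedSpace ℝ E]
    (M : Type*) [TopologicalSpace M] [ChartedSpace E M] [IsManifold 𝓘(ℝ, E) ∞ M] where
  /-- The metric. -/
  g : PseudoMetric E M
  /-- The almost complex structures. -/
  J : Fin 3 → EndField E M
  J_sq (α : Fin 3) (x : M) (v : TangentSpace 𝓘(ℝ, E) x) :
    (J α).val x ((J α).val x v) = -v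
  J_eq (α : Fin 3) (x : M) (v : TangentSpace 𝓘(ℝ, E) x) :
    (J α).val x v = (J (α + 1)).val x ((J (α + 2)).val x v)
  J_eq_neg (α : Fin 3) (x : M) (v : TangentSpace 𝓘(ℝ, E) x) :
    (J α).val x v = -(J (α + 2)).val x ((J (α + 1)).val x v)
  compat (α : Fin 3) (x : M) (v w : TangentSpace 𝓘(ℝ, E) x) :
    g.val x v w = eps α * g.val x ((J α).val x v) ((J α).val x w)

section

variable [FiniteDimensional ℝ E]

/-- The tensor `(D_v J) w`, where `(D_X J) Y = D_X (J Y) - J (D_X Y)`. -/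
def EndField.covDeriv (J : EndField E M) (D : Connection E M) (x : M)
    (v w : TangentSpace 𝓘(ℝ, E) x) : TangentSpace 𝓘(ℝ, E) x :=
  TensorialAt.mkHom _ x (J.tensorialAt_covDeriv D x) w v

theorem EndField.covDeriv_apply (J : EndField E M) (D : Connection E M) (x : M)
    (v : TangentSpace 𝓘(ℝ, E) x) {Y : VField E M} (hY : MDiffAt (T% Y) x) :
    J.covDeriv D x v (Y x) = D (fun p => J.val p (Y p)) x v - J.val x (D Y x v) := by
  unfold EndField.covDeriv
  rw [TensorialAt.mkHom_apply (J.tensorialAt_covDeriv D x) hY]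
  rfl

/-- `D J = 0`. -/
def EndField.IsParallel (J : EndField E M) (D : Connection E M) : Prop :=
  ∀ (x : M) (v w : TangentSpace 𝓘(ℝ, E) x), J.covDeriv D x v w = 0

/-- The structural tensors `F_α(u, v, w) = g((∇_u J_α) v, w)`. -/
def AlmostHGStructure.F (S : AlmostHGStructure E M) (nabla : Connection E M) (α : Fin 3) (x : M)
    (u v w : TangentSpace 𝓘(ℝ, E) x) : ℝ :=
  S.g.val x ((S.J α).covDeriv nabla x u v) w

/-- The class `W₁₃₃`, `nabla` being the Levi-Civita connection: nearly Kähler with respect to `J₁`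
and quasi-Kähler with Norden metric with respect to `J₂` and `J₃`. -/
structure AlmostHGStructure.IsW133 (S : AlmostHGStructure E M) (nabla : Connection E M) :
    Prop where
  nearlyKahler : ∀ (x : M) (u v w : TangentSpace 𝓘(ℝ, E) x),
    S.F nabla 0 x u v w = -S.F nabla 0 x v u w
  quasiKahler : ∀ α : Fin 3, α ≠ 0 → ∀ (x : M) (u v w : TangentSpace 𝓘(ℝ, E) x),
    S.F nabla α x u v w + S.F nabla α x v w u + S.F nabla α x w u v = 0

/-- The manifold is isotropic-hyper-Kähler: `‖∇J_α‖² = 0` for `α = 1, 2, 3`. -/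
def AlmostHGStructure.IsIsotropicHyperKahler (S : AlmostHGStructure E M)
    (nabla : Connection E M) : Prop :=
  ∀ (α : Fin 3) (x : M)
    (e : Module.Basis (Fin (Module.finrank ℝ E)) ℝ (TangentSpace 𝓘(ℝ, E) x)),
    S.g.sqNorm e ((S.J α).covDeriv nabla x) = 0

variable [CompleteSpace E]

/-- `nabla` is the Levi-Civita connection of `g`. -/
structure PseudoMetric.IsLeviCivita (g : PseudoMetric E M) (nabla : Connection E M) : Prop where
  smooth : nabla.ContMDiffCovariantDerivative ∞
  metric : g.IsParallel nabla
  torsion_eq_zero : nabla.torsion = 0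

/-- The torsion of `D` as a tensor of type (0,3), `T(u, v, w) = g(T(u, v), w)`. -/
def PseudoMetric.torsion₃ (g : PseudoMetric E M) (D : Connection E M) (x : M)
    (u v w : TangentSpace 𝓘(ℝ, E) x) : ℝ :=
  g.val x (D.torsion x u v) w

/-- `D` is a pseudo-HKT-connection: a linear connection preserving `g` and all the `J_α` whose
torsion is totally skew-symmetric. -/
structure AlmostHGStructure.IsPHKT (S : AlmostHGStructure E M) (D : Connection E M) : Prop where
  smooth : D.ContMDiffCovariantDerivative ∞
  metric : S.g.IsParallel D
  parallel : ∀ α : Fin 3, (S.J α).IsParallel D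
  skew₁₂ : ∀ (x : M) (u v w : TangentSpace 𝓘(ℝ, E) x),
    S.g.torsion₃ D x u v w = -S.g.torsion₃ D x v u w
  skew₂₃ : ∀ (x : M) (u v w : TangentSpace 𝓘(ℝ, E) x),
    S.g.torsion₃ D x u v w = -S.g.torsion₃ D x u w v

/-- `D` is strong: its torsion 3-form is closed, `dT = 0`. -/
def PseudoMetric.IsStrong (g : PseudoMetric E M) (D : Connection E M) : Prop :=
  ∀ X Y Z W : VField E M, IsSmooth X → IsSmooth Y → IsSmooth Z → IsSmooth W →
    ∀ x, extDeriv₃ (g.torsion₃ D) X Y Z W x = 0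

/-- The torsion of `D` is isotropic: `‖T‖² = 0`. -/
def PseudoMetric.HasIsotropicTorsion (g : PseudoMetric E M) (D : Connection E M) : Prop :=
  ∀ (x : M) (e : Module.Basis (Fin (Module.finrank ℝ E)) ℝ (TangentSpace 𝓘(ℝ, E) x)),
    g.sqNorm e (fun u v => D.torsion x u v) = 0

end

end PHKT

end

/-!
For a metric connection with skew torsion `D = ∇ + T / 2`, so the tensors `∇ J_α` are algebraic in
`T`. In the class `W₁₃₃` the nearly Kähler condition for `J₁` says exactly that the 3-form `T` has
type (3,0)+(0,3) with respect to `J₁`: one may move `J₁` between its arguments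
(`AlmostHGStructure.IsPHKT.torsion_J_right`). As `D J₁ = 0`, the same holds for each `D_X T`.

Let `σ(X, Y, Z, W)` be the cyclic sum over `X, Y, Z` of `g(T(X, Y), T(Z, W))`. The alternation of
`D T` equals `dT - 2 σ`, so it is `-2 σ` if `D` is strong; if `D` is flat, the first Bianchi identity
gives `-(4 / 3) σ`. In either case, replacing pairs of arguments by their images under `J₁` and
comparing signs gives `g(T(X, Y), T(Z, W)) = 0` for all arguments
(`eq_zero_of_alternation`, `AlmostHGStructure.IsPHKT.torsion_null`). This contains `‖T‖² = 0`, and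
it shows that flat `D` is also strong. All terms of `‖∇ J₁‖²` vanish too. For `J₂` and `J₃` there
remain cross terms `g(T(X, J_α Y), J_α T(Z, W))`; they change sign when `J₁` is applied to `X` and
`Z`, because `J₁` and `J_α` anticommute, so their trace vanishes (`sum_inv_mul_eq_zero`).

With `T` null and `dT = 0`, the curvatures of `D` and `∇` differ by half of
`P(X, Y, Z, W) = (D_X T)(Y, Z, W) - (D_Y T)(X, Z, W)`, which is antisymmetric under the exchange of
pairs. The curvature of `D` commutes with `J₁` and that of `∇` has the pair symmetry, and this forces
`P = 0` (`eq_zero_of_kaehler_exchange`). So the curvature `R` of `∇` commutes with all `J_α`. Since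
`J₂` and `J₃` are `g`-symmetric, `R(X, Y, Z, J_α W)` is again an algebraic curvature tensor for
`α = 2, 3`; by its pair symmetry, the anticommuting `J₂` and `J₃` can be interchanged inside `R`, and
`R = 0` (`comp_eq_zero_of_norden_kaehler`).

Pointwise identities are obtained on global smooth vector fields, to which every tangent vector
extends. The algebraic lemmas are stated for functions on an arbitrary set, to be applied to the set
of smooth vector fields.
-/

noncomputable section

namespace PHKT

/-! ### Algebraic curvature identities -/

section Algebra

variable {V : Type*}

/-- The pair symmetry of an algebraic curvature tensor. No linear structure on `V` is needed, so that
`V` may be the set of smooth vector fields. -/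
theorem pair_symm_of_bianchi {R : V → V → V → V → ℝ}
    (h₁₂ : ∀ x y z w, R x y z w = -R y x z w) (h₃₄ : ∀ x y z w, R x y z w = -R x y w z)
    (hB : ∀ x y z w, R x y z w + R y z x w + R z x y w = 0) (x y z w : V) :
    R x y z w = R z w x y := by
  linarith [hB x y z w, hB y z w x, hB z w x y, hB w x y z, h₃₄ y z w x, h₃₄ z w y x, h₁₂ w y z x,
    h₃₄ y w z x, h₃₄ w x z y, h₁₂ x z w y, h₃₄ z x w y, h₃₄ x y w z]

/-- A curvature tensor that is Kähler for two anticommuting Norden structures `J`, `K` vanishes after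
composition with `J K`. For each structure separately, `R(x, y, z, J w)` is again an algebraic
curvature tensor, so `J` can be moved across the pairs; moving both, in either order, exchanges
`J K` with `K J = -J K`. -/
theorem comp_eq_zero_of_norden_kaehler {R : V → V → V → V → ℝ} {J K : V → V}
    (h₁₂ : ∀ x y z w, R x y z w = -R y x z w) (h₃₄ : ∀ x y z w, R x y z w = -R x y w z)
    (hB : ∀ x y z w, R x y z w + R y z x w + R z x y w = 0)
    (hJ : ∀ x y z w, R x y (J z) w = R x y z (J w))
    (hK : ∀ x y z w, R x y (K z) w = R x y z (K w))
    (hJK : ∀ x y z w, R x y z (J (K w)) = -R x y z (K (J w))) (x y z w : V) :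
    R x y z (J (K w)) = 0 := by
  have hs := pair_symm_of_bianchi h₁₂ h₃₄ hB
  have hsJ : ∀ x y z w, R x y z (J w) = R z w x (J y) :=
    pair_symm_of_bianchi (R := fun x y z w => R x y z (J w)) (fun x y z w => h₁₂ x y z _)
      (fun x y z w => by rw [h₃₄, hJ]) (fun x y z w => hB x y z _)
  -- `J` goes across the pairs, `K` goes to the neighbour, and `J` goes back.
  have h1 : R x y z (J (K w)) = R x y (K z) (J w) := by
    rw [hsJ, hs, ← hK, hs, ← hs x (J y), hs x (J y), ← hsJ]
  rw [hK] at h1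
  linarith [hJK x y z w]

/-- Signs picked up by a family `A x` of 3-forms which is pure for the complex structure `I`, that is,
`I` can be moved freely between the arguments of the form. -/
theorem pure_form_comp {A : V → V → V → V → ℝ} {I : V → V}
    (hA₂₃ : ∀ x y z w, A x y z w = -A x z y w) (hA₃₄ : ∀ x y z w, A x y z w = -A x y w z)
    (hAI : ∀ x y z w, A x (I y) z w = A x y (I z) w)
    (hAII : ∀ x y z w, A x (I (I y)) z w = -A x y z w) :
    (∀ x y z w, A x (I y) (I z) w = -A x y z w) ∧ (∀ x y z w, A x y (I z) (I w) = -A x y z w) ∧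
      ∀ x y z w, A x (I y) z (I w) = -A x y z w := by
  have hAI2 : ∀ x y z w, A x (I y) (I z) w = -A x y z w := fun x y z w => by rw [← hAI, hAII]
  refine ⟨hAI2, fun x y z w => ?_, fun x y z w => ?_⟩
  · rw [hA₂₃, hA₃₄, hA₂₃, hAI2]; linarith [hA₂₃ x z w y, hA₃₄ x z y w, hA₂₃ x y z w]
  · rw [hA₃₄, hAI2, hA₃₄ x y z w]

/-- The null torsion lemma. Here `A` stands for `D T` and `q x y z w` for `g(T(x, y), T(z, w))`, with
`T` of type (3,0)+(0,3). Under `I` on a pair of arguments, the three terms of the cyclic sum of `q`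
change sign differently, whereas the terms of the alternation of `A` change in a way that cancels
when all positions are combined; this isolates sums of two of the three terms of `q`. -/
theorem eq_zero_of_alternation {A q : V → V → V → V → ℝ} {I : V → V} {κ : ℝ} (hκ : κ ≠ 0)
    (hA₂₃ : ∀ x y z w, A x y z w = -A x z y w) (hA₃₄ : ∀ x y z w, A x y z w = -A x y w z)
    (hAI : ∀ x y z w, A x (I y) z w = A x y (I z) w)
    (hAII : ∀ x y z w, A x (I (I y)) z w = -A x y z w)
    (hq : ∀ x y z w, q x y z w = -q y x z w) (hqs : ∀ x y z w, q x y z w = q z w x y)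
    (hqI : ∀ x y z w, q (I x) y z w = q x (I y) z w)
    (hqII : ∀ x y z w, q x (I (I y)) z w = -q x y z w)
    (hqII' : ∀ x y z w, q x (I y) z (I w) = q x y z w)
    (hs : ∀ x y z w, A x y z w - A y x z w + A z x y w - A w x y z =
      κ * (q x y z w + q y z x w + q z x y w)) (x y z w : V) :
    q x y z w = 0 := by
  obtain ⟨hAI2, hAI3, -⟩ := pure_form_comp hA₂₃ hA₃₄ hAI hAII
  have hqI2 : ∀ x y z w, q (I x) (I y) z w = -q x y z w := fun x y z w => by rw [hqI, hqII]
  have hqI3 : ∀ x y z w, q x y (I z) (I w) = -q x y z w := fun x y z w => by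
    rw [hqs, hqI2, hqs]
  have hqI4 : ∀ x y z w, q (I x) y (I z) w = q x y z w := fun x y z w => by
    rw [hqI, hqs, hqI, hqII', hqs]
  have hqI5 : ∀ x y z w, q x (I y) (I z) w = q x y z w := fun x y z w => by
    rw [hq, hqI4, ← hq]
  have hqI6 : ∀ x y z w, q (I x) y z (I w) = q x y z w := fun x y z w => by
    rw [hqI, hqII']
  have key : ∀ x y z w, q y z x w + q z x y w = 0 := by
    intro x y z w
    have e1 := hs x y z w
    have e2 := hs (I x) (I y) z w
    have e3 := hs x y (I z) (I w)
    have e4 := hs (I x) (I y) (I z) (I w)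
    rw [hAI2, hAI2, hqI2, hqI4, hqI5] at e2
    rw [hAI3, hAI3, hqI3, hqII', hqI6] at e3
    rw [hAI3, hAI3, hAI2, hAI2, hqI2, hqI3, hqI2, hqI3, hqI2, hqI3] at e4
    have : κ * (q y z x w + q z x y w) = 0 := by linarith
    exact (mul_eq_zero.mp this).resolve_left hκ
  linarith [key x y z w, key y z x w, key z x y w, hq x y z w, hq y z x w, hq z x y w]

/-- If the alternation of `A` vanishes, the purity of `A x` for `I` extends to the argument `x`. -/
theorem pure_form_of_alternation_eq_zero {A : V → V → V → V → ℝ} {I : V → V}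
    (hA₂₃ : ∀ x y z w, A x y z w = -A x z y w) (hA₃₄ : ∀ x y z w, A x y z w = -A x y w z)
    (hAI : ∀ x y z w, A x (I y) z w = A x y (I z) w)
    (hAII : ∀ x y z w, A x (I (I y)) z w = -A x y z w)
    (hs : ∀ x y z w, A x y z w - A y x z w + A z x y w - A w x y z = 0) (x y z w : V) :
    A (I x) (I y) z w = -A x y z w := by
  obtain ⟨hAI2, hAI3, hAI4⟩ := pure_form_comp hA₂₃ hA₃₄ hAI hAII
  have e1 := hs (I x) (I y) z w
  have e2 := hs (I x) y (I z) w
  have e3 := hs x (I y) (I z) w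
  have e0 := hs x y z w
  rw [hAI2, hAI2] at e1
  rw [← hAI, hAI2, hAI4] at e2
  rw [hAI2, ← hAI, ← hAI, hAI3] at e3
  linarith

/-- If the failure `P` of the curvature-like tensor `R` to be `I`-invariant in its second pair is
antisymmetric under exchange of pairs and pure for `I`, it vanishes: transforming all four arguments
of `R` yields `R - 2 P`, and this must be symmetric under exchange of pairs. -/
theorem eq_zero_of_kaehler_exchange {R P : V → V → V → V → ℝ} {I : V → V}
    (hR : ∀ x y z w, R x y z w = R z w x y)
    (hRI : ∀ x y z w, R x y (I z) (I w) = R x y z w + P x y z w)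
    (hP : ∀ x y z w, P x y z w = -P z w x y)
    (hPI : ∀ x y z w, P (I x) (I y) z w = -P x y z w) (x y z w : V) : P x y z w = 0 := by
  have key : ∀ x y z w, R (I x) (I y) (I z) (I w) = R x y z w - 2 * P x y z w := by
    intro x y z w
    rw [hRI, hPI, hR, hRI, ← hR, hP z w x y]; ring
  linarith [key x y z w, key z w x y, hR (I x) (I y) (I z) (I w), hR x y z w, hP x y z w]

end Algebra

/-! ### Smooth vector fields and the Lie bracket -/

section

variable {E : Type*} [NormedAddCommGroup E] [NormedSpace ℝ E]
  {M : Type*} [TopologicalSpace M] [ChartedSpace E M] [IsManifold 𝓘(ℝ, E) ∞ M]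

theorem IsSmooth.mdifferentiableAt {X : VField E M} (hX : IsSmooth X) (x : M) :
    MDiffAt (T% X) x :=
  (hX x).mdifferentiableAt (by simp)

theorem IsSmooth.contMDiffAt_minSmoothness {X : VField E M} (hX : IsSmooth X) (x : M) :
    ContMDiffAt 𝓘(ℝ, E) (𝓘(ℝ, E).prod 𝓘(ℝ, E)) (minSmoothness ℝ 2) (T% X) x :=
  (hX x).of_le (by simpa using WithTop.coe_le_coe.2 (le_top : (2 : ℕ∞) ≤ ⊤))

theorem IsSmooth.sub {X Y : VField E M} (hX : IsSmooth X) (hY : IsSmooth Y) :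
    IsSmooth (X - Y) :=
  ContMDiff.sub_section hX hY

theorem IsSmooth.smul {f : M → ℝ} {X : VField E M} (hf : ContMDiff 𝓘(ℝ, E) 𝓘(ℝ) ∞ f)
    (hX : IsSmooth X) : IsSmooth (f • X) :=
  ContMDiff.smul_section hf hX

/-- Every tangent vector extends to a global smooth vector field, cut off by a bump function; this
uses that `M` is Hausdorff. -/
theorem exists_isSmooth_eq [FiniteDimensional ℝ E] [T2Space M] (x : M)
    (v : TangentSpace 𝓘(ℝ, E) x) : ∃ X : VField E M, IsSmooth X ∧ X x = v := by
  obtain ⟨s, hs, hsm⟩ := FiberBundle.exists_contMDiffOn_extend (k := ∞) 𝓘(ℝ, E) E v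
  obtain ⟨f, -, hf⟩ := (SmoothBumpFunction.nhds_basis_tsupport (I := 𝓘(ℝ, E)) x).mem_iff.1
    (interior_mem_nhds.2 hs)
  refine ⟨(f : M → ℝ) • FiberBundle.extend E v, ?_, ?_⟩
  · exact ContMDiffOn.smul_section_of_tsupport f.contMDiff.contMDiffOn isOpen_interior hf
      (hsm.mono interior_subset)
  · simp

/-- The vector field `D_X Y`. -/
def Connection.along (D : Connection E M) (X Y : VField E M) : VField E M := fun p => D Y p (X p)

theorem Connection.along_apply (D : Connection E M) (X Y : VField E M) (x : M) :
    D.along X Y x = D Y x (X x) := rfl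

theorem IsSmooth.along {D : Connection E M} (hD : D.ContMDiffCovariantDerivative ∞)
    {X Y : VField E M} (hX : IsSmooth X) (hY : IsSmooth Y) : IsSmooth (Connection.along D X Y) := by
  have := hD.contMDiff.contMDiff (σ := Y) (by simpa using hY.contMDiffOn)
  exact ContMDiff.clm_bundle_apply (F₁ := E) (F₂ := E) (contMDiffOn_univ.1 this) hX

theorem EndField.isSmooth_apply (J : EndField E M) {X : VField E M} (hX : IsSmooth X) :
    IsSmooth (fun p => J.val p (X p)) :=
  ContMDiff.clm_bundle_apply (F₁ := E) (F₂ := E) J.contMDiff hX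

theorem PseudoMetric.contMDiff_apply (g : PseudoMetric E M) {X Y : VField E M} (hX : IsSmooth X)
    (hY : IsSmooth Y) : ContMDiff 𝓘(ℝ, E) 𝓘(ℝ) ∞ (fun p => g.val p (X p) (Y p)) := by
  have := ContMDiff.clm_bundle_apply₂ (F₁ := E) (F₂ := E) (F₃ := ℝ) (E₃ := Bundle.Trivial M ℝ)
    g.contMDiff hX hY
  intro x
  exact (Bundle.contMDiffAt_section _ |>.1 (this x))

variable [CompleteSpace E]

theorem IsSmooth.mlieBracket {X Y : VField E M} (hX : IsSmooth X) (hY : IsSmooth Y) :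
    IsSmooth (VectorField.mlieBracket 𝓘(ℝ, E) X Y) := by
  have : IsManifold 𝓘(ℝ, E) (minSmoothness ℝ 2) M :=
    .of_le (n := ∞) (by simpa using WithTop.coe_le_coe.2 (le_top : (2 : ℕ∞) ≤ ⊤))
  have : IsManifold 𝓘(ℝ, E) ((⊤ : ℕ∞) + 1) M := .of_le (n := ∞) (by simp)
  intro x
  exact ContMDiffAt.mlieBracket_vectorField (m := ⊤) (n := ⊤) (hX x) (hY x) (by simp)

/-- The Lie bracket acts on functions as a commutator. This follows from the Jacobi identity for
`X`, `Y`, `f Z` and the Leibniz rule, where `Z` is a vector field with `Z x ≠ 0`. -/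
theorem dirDeriv_mlieBracket [FiniteDimensional ℝ E] [T2Space M] {X Y : VField E M}
    (hX : IsSmooth X) (hY : IsSmooth Y)
    {f : M → ℝ} (hf : ContMDiff 𝓘(ℝ, E) 𝓘(ℝ) ∞ f) (x : M)
    (hXf : MDiffAt (fun p => dirDeriv f p (X p)) x) (hYf : MDiffAt (fun p => dirDeriv f p (Y p)) x) :
    dirDeriv f x (VectorField.mlieBracket 𝓘(ℝ, E) X Y x) =
      dirDeriv (fun p => dirDeriv f p (Y p)) x (X x)
        - dirDeriv (fun p => dirDeriv f p (X p)) x (Y x) := by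
  -- On a zero tangent space no such `Z` exists, and both sides vanish.
  by_cases hE : ∀ v : TangentSpace 𝓘(ℝ, E) x, v = 0
  · rw [hE (VectorField.mlieBracket 𝓘(ℝ, E) X Y x), hE (X x), hE (Y x)]; simp [dirDeriv]
  push Not at hE
  obtain ⟨v, hv⟩ := hE
  obtain ⟨Z, hZ, rfl⟩ := exists_isSmooth_eq x v
  have : IsManifold 𝓘(ℝ, E) (minSmoothness ℝ 3) M :=
    .of_le (n := ∞) (by simpa using WithTop.coe_le_coe.2 (le_top : (3 : ℕ∞) ≤ ⊤))
  have hfx : ∀ p, MDiffAt f p := fun p => (hf p).mdifferentiableAt (by simp)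
  have hb : ∀ W : VField E M, VectorField.mlieBracket 𝓘(ℝ, E) W (f • Z) =
      (fun p => dirDeriv f p (W p)) • Z + f • VectorField.mlieBracket 𝓘(ℝ, E) W Z := by
    intro W
    funext p
    exact VectorField.mlieBracket_smul_right (hfx p) (hZ.mdifferentiableAt p)
  have h2 : ∀ W : VField E M, IsSmooth W → MDiffAt (fun p => dirDeriv f p (W p)) x →
      ∀ U : VField E M,
      VectorField.mlieBracket 𝓘(ℝ, E) U (VectorField.mlieBracket 𝓘(ℝ, E) W (f • Z)) x =
      dirDeriv (fun p => dirDeriv f p (W p)) x (U x) • Z x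
        + dirDeriv f x (W x) • VectorField.mlieBracket 𝓘(ℝ, E) U Z x
        + (dirDeriv f x (U x) • VectorField.mlieBracket 𝓘(ℝ, E) W Z x + f x •
          VectorField.mlieBracket 𝓘(ℝ, E) U (VectorField.mlieBracket 𝓘(ℝ, E) W Z) x) := by
    intro W hW hWf U
    have hWZ := (hW.mlieBracket hZ).mdifferentiableAt x
    rw [hb W, VectorField.mlieBracket_add_right (hWf.smul_section (hZ.mdifferentiableAt x))
      ((hfx x).smul_section hWZ), VectorField.mlieBracket_smul_right hWf (hZ.mdifferentiableAt x),
      VectorField.mlieBracket_smul_right (hfx x) hWZ]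
    rfl
  have hJ := VectorField.leibniz_identity_mlieBracket_apply (hX.contMDiffAt_minSmoothness x)
    (hY.contMDiffAt_minSmoothness x) ((hZ.smul hf).contMDiffAt_minSmoothness x)
  have hJ' := VectorField.leibniz_identity_mlieBracket_apply (hX.contMDiffAt_minSmoothness x)
    (hY.contMDiffAt_minSmoothness x) (hZ.contMDiffAt_minSmoothness x)
  rw [h2 Y hY hYf, h2 X hX hXf, hb, hJ'] at hJ
  have : (dirDeriv f x (VectorField.mlieBracket 𝓘(ℝ, E) X Y x) -
      (dirDeriv (fun p => dirDeriv f p (Y p)) x (X x)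
        - dirDeriv (fun p => dirDeriv f p (X p)) x (Y x))) • Z x = 0 := by
    simp only [Pi.add_apply, Pi.smul_apply'] at hJ
    rw [sub_smul, sub_smul]
    linear_combination (norm := module) (-1 : ℝ) • hJ
  exact sub_eq_zero.1 ((smul_eq_zero.1 this).resolve_right hv)

end

/-! ### Connections and their curvature -/

section

variable {E : Type*} [NormedAddCommGroup E] [NormedSpace ℝ E]
  {M : Type*} [TopologicalSpace M] [ChartedSpace E M]

theorem dirDeriv_add {f h : M → ℝ} {x : M} (hf : MDiffAt f x) (hh : MDiffAt h x)
    (v : TangentSpace 𝓘(ℝ, E) x) :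
    dirDeriv (fun p => f p + h p) x v = dirDeriv f x v + dirDeriv h x v := by
  have := mvfderiv_add hf hh
  exact congr($this v)

theorem dirDeriv_const_mul (c : ℝ) {f : M → ℝ} {x : M} (hf : MDiffAt f x)
    (v : TangentSpace 𝓘(ℝ, E) x) :
    dirDeriv (fun p => c * f p) x v = c * dirDeriv f x v := by
  have := mvfderiv_mul (mdifferentiableAt_const (c := c)) hf
  have h0 : d% (fun _ : M => c) x = 0 := mvfderiv_const c
  rw [h0, smul_zero, add_zero] at this
  exact congr($this v)

theorem dirDeriv_neg (f : M → ℝ) (x : M) (v : TangentSpace 𝓘(ℝ, E) x) :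
    dirDeriv (fun p => -f p) x v = -dirDeriv f x v := by
  have := mvfderiv_neg (I := 𝓘(ℝ, E)) (g := f) (x := x)
  exact congr($this v)

variable [IsManifold 𝓘(ℝ, E) ∞ M]

theorem Connection.sub_apply (D : Connection E M) {Y Z : VField E M} (hY : IsSmooth Y)
    (hZ : IsSmooth Z) (x : M) : D (Y - Z) x = D Y x - D Z x := by
  have h := D.isCovariantDerivativeOn.add (s := Set.univ)
    ((hY.sub hZ).mdifferentiableAt x) (hZ.mdifferentiableAt x)
  rw [sub_add_cancel] at h
  rw [h, add_sub_cancel_right]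

/-- A tangent vector is determined by its products with smooth vector fields. -/
theorem PseudoMetric.ext_of_isSmooth [FiniteDimensional ℝ E] [T2Space M]
    (g : PseudoMetric E M) {x : M} {v w : TangentSpace 𝓘(ℝ, E) x}
    (h : ∀ W : VField E M, IsSmooth W → g.val x v (W x) = g.val x w (W x)) : v = w := by
  refine sub_eq_zero.1 (g.nondegenerate x _ fun u => ?_)
  obtain ⟨W, hW, rfl⟩ := exists_isSmooth_eq x u
  rw [map_sub, sub_apply, h W hW, sub_self]

theorem PseudoMetric.mdifferentiableAt_apply (g : PseudoMetric E M) {X Y : VField E M}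
    (hX : IsSmooth X) (hY : IsSmooth Y) (x : M) : MDiffAt (fun p => g.val p (X p) (Y p)) x :=
  (g.contMDiff_apply hX hY x).mdifferentiableAt (by simp)

theorem curvature_apply (D : Connection E M) (X Y Z : VField E M) (x : M) :
    curvature D X Y Z x = D (D.along Y Z) x (X x) - D (D.along X Z) x (Y x)
      - D Z x (VectorField.mlieBracket 𝓘(ℝ, E) X Y x) := rfl

theorem curvature_swap (D : Connection E M) (X Y Z : VField E M) (x : M) :
    curvature D X Y Z x = -curvature D Y X Z x := by
  simp only [curvature]
  rw [VectorField.mlieBracket_swap_apply, map_neg]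
  abel

/-- The curvature of a connection preserving `J` commutes with `J`. -/
theorem curvature_endField {D : Connection E M} (J : EndField E M)
    (hJ : ∀ Z : VField E M, IsSmooth Z → ∀ p v, D (fun p => J.val p (Z p)) p v = J.val p (D Z p v))
    (hD : D.ContMDiffCovariantDerivative ∞)
    {X Y Z : VField E M} (hX : IsSmooth X) (hY : IsSmooth Y) (hZ : IsSmooth Z) (x : M) :
    curvature D X Y (fun p => J.val p (Z p)) x = J.val x (curvature D X Y Z x) := by
  have h : ∀ U, D.along U (fun p => J.val p (Z p)) = fun p => J.val p (D.along U Z p) :=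
    fun U => funext fun p => hJ Z hZ p (U p)
  simp only [curvature_apply, h, map_sub]
  rw [hJ _ (hY.along hD hZ), hJ _ (hX.along hD hZ), hJ Z hZ]

variable [CompleteSpace E] [FiniteDimensional ℝ E]

/-- The curvature of a metric connection is skew-symmetric in its last two arguments. -/
theorem curvature_skew [T2Space M] (g : PseudoMetric E M) {D : Connection E M}
    (hD : D.ContMDiffCovariantDerivative ∞) (hg : g.IsParallel D) {X Y Z W : VField E M}
    (hX : IsSmooth X) (hY : IsSmooth Y) (hZ : IsSmooth Z) (hW : IsSmooth W) (x : M) :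
    g.val x (curvature D X Y Z x) (W x) = -g.val x (curvature D X Y W x) (Z x) := by
  have hd : ∀ {U : VField E M}, IsSmooth U →
      (fun p => dirDeriv (fun p => g.val p (Z p) (W p)) p (U p)) = fun p =>
        g.val p (D.along U Z p) (W p) + g.val p (Z p) (D.along U W p) := by
    intro U hU
    funext p
    exact hg Z W hZ hW p (U p)
  have hdd : ∀ {U : VField E M}, IsSmooth U → ∀ v,
      dirDeriv (fun p => dirDeriv (fun p => g.val p (Z p) (W p)) p (U p)) x v =
        g.val x (D (D.along U Z) x v) (W x) + g.val x (D.along U Z x) (D W x v)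
        + (g.val x (D Z x v) (D.along U W x) + g.val x (Z x) (D (D.along U W) x v)) := by
    intro U hU v
    rw [hd hU, dirDeriv_add (g.mdifferentiableAt_apply (hU.along hD hZ) hW x)
      (g.mdifferentiableAt_apply hZ (hU.along hD hW) x), hg _ _ (hU.along hD hZ) hW,
      hg _ _ hZ (hU.along hD hW)]
  have hm : ∀ {U : VField E M}, IsSmooth U →
      MDiffAt (fun p => dirDeriv (fun p => g.val p (Z p) (W p)) p (U p)) x := by
    intro U hU
    rw [hd hU]
    exact (g.mdifferentiableAt_apply (hU.along hD hZ) hW x).add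
      (g.mdifferentiableAt_apply hZ (hU.along hD hW) x)
  have h := dirDeriv_mlieBracket hX hY (g.contMDiff_apply hZ hW) x (hm hX) (hm hY)
  rw [hdd hX, hdd hY, hg Z W hZ hW] at h
  rw [g.symm x (curvature D X Y W x)]
  simp only [curvature_apply, map_sub, sub_apply]
  simp only [Connection.along_apply] at h
  linarith

/-- The first Bianchi identity for a torsion-free connection. -/
theorem curvature_bianchi {D : Connection E M}
    (hD : D.ContMDiffCovariantDerivative ∞) (hT : D.torsion = 0) {X Y Z : VField E M}
    (hX : IsSmooth X) (hY : IsSmooth Y) (hZ : IsSmooth Z) (x : M) :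
    curvature D X Y Z x + curvature D Y Z X x + curvature D Z X Y x = 0 := by
  have hb : ∀ {U V : VField E M}, IsSmooth U → IsSmooth V →
      VectorField.mlieBracket 𝓘(ℝ, E) U V = D.along U V - D.along V U := by
    intro U V hU hV
    funext p
    exact (D.torsion_eq_zero_iff.1 hT (hU.mdifferentiableAt p) (hV.mdifferentiableAt p)).symm
  have hbx : ∀ {U V : VField E M}, IsSmooth U → IsSmooth V →
      VectorField.mlieBracket 𝓘(ℝ, E) U V x = D V x (U x) - D U x (V x) := by
    intro U V hU hV
    rw [hb hU hV]; rfl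
  have hbb : ∀ {U V W : VField E M}, IsSmooth U → IsSmooth V → IsSmooth W →
      VectorField.mlieBracket 𝓘(ℝ, E) U (VectorField.mlieBracket 𝓘(ℝ, E) V W) x =
      D (D.along V W) x (U x) - D (D.along W V) x (U x)
        - D U x (VectorField.mlieBracket 𝓘(ℝ, E) V W x) := by
    intro U V W hU hV hW
    rw [hbx hU (hV.mlieBracket hW), hb hV hW,
      Connection.sub_apply D (hV.along hD hW) (hW.along hD hV)]
    rfl
  have : IsManifold 𝓘(ℝ, E) (minSmoothness ℝ 3) M :=
    .of_le (n := ∞) (by simpa using WithTop.coe_le_coe.2 (le_top : (3 : ℕ∞) ≤ ⊤))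
  have hJ := VectorField.leibniz_identity_mlieBracket_apply (hX.contMDiffAt_minSmoothness x)
    (hY.contMDiffAt_minSmoothness x) (hZ.contMDiffAt_minSmoothness x)
  rw [VectorField.mlieBracket_swap_apply (V := VectorField.mlieBracket 𝓘(ℝ, E) X Y),
    hbb hX hY hZ, hbb hY hX hZ, hbb hZ hX hY,
    VectorField.mlieBracket_swap_apply (V := X) (W := Z), map_neg] at hJ
  simp only [curvature_apply]
  linear_combination (norm := module) (1 : ℝ) • hJ

end

/-! ### Metric connections with skew torsion -/

section

variable {E : Type*} [NormedAddCommGroup E] [NormedSpace ℝ E]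
  {M : Type*} [TopologicalSpace M] [ChartedSpace E M] [IsManifold 𝓘(ℝ, E) ∞ M]
  [CompleteSpace E] [FiniteDimensional ℝ E]

/-- A smooth metric connection whose torsion is a 3-form. -/
structure PseudoMetric.IsSkewTorsion (g : PseudoMetric E M) (D : Connection E M) : Prop where
  smooth : D.ContMDiffCovariantDerivative ∞
  metric : g.IsParallel D
  skew₁₂ : ∀ (x : M) (u v w : TangentSpace 𝓘(ℝ, E) x),
    g.torsion₃ D x u v w = -g.torsion₃ D x v u w
  skew₂₃ : ∀ (x : M) (u v w : TangentSpace 𝓘(ℝ, E) x),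
    g.torsion₃ D x u v w = -g.torsion₃ D x u w v

/-- The vector field `T(X, Y)`. -/
def Connection.torsionField (D : Connection E M) (X Y : VField E M) : VField E M :=
  fun p => D.torsion p (X p) (Y p)

theorem mlieBracket_eq_along (D : Connection E M) {X Y : VField E M} (hX : IsSmooth X)
    (hY : IsSmooth Y) (x : M) : VectorField.mlieBracket 𝓘(ℝ, E) X Y x =
      D Y x (X x) - D X x (Y x) - D.torsion x (X x) (Y x) := by
  rw [D.torsion_apply (hX.mdifferentiableAt x) (hY.mdifferentiableAt x)]
  abel

theorem IsSmooth.torsionField {D : Connection E M} (hD : D.ContMDiffCovariantDerivative ∞)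
    {X Y : VField E M} (hX : IsSmooth X) (hY : IsSmooth Y) : IsSmooth (D.torsionField X Y) := by
  have : D.torsionField X Y = D.along X Y - D.along Y X - VectorField.mlieBracket 𝓘(ℝ, E) X Y :=
    funext fun p => D.torsion_apply (hX.mdifferentiableAt p) (hY.mdifferentiableAt p)
  rw [this]
  exact ((hX.along hD hY).sub (hY.along hD hX)).sub (hX.mlieBracket hY)

/-- The covariant derivative `(D_X T)(Y, Z, W)` of the torsion 3-form, on vector fields. -/
def PseudoMetric.covDerivTorsion (g : PseudoMetric E M) (D : Connection E M)
    (X Y Z W : VField E M) (x : M) : ℝ :=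
  dirDeriv (fun p => g.torsion₃ D p (Y p) (Z p) (W p)) x (X x)
    - g.torsion₃ D x (D Y x (X x)) (Z x) (W x)
    - g.torsion₃ D x (Y x) (D Z x (X x)) (W x)
    - g.torsion₃ D x (Y x) (Z x) (D W x (X x))

variable {g : PseudoMetric E M} {D nabla : Connection E M}

theorem PseudoMetric.IsSkewTorsion.cyclic (hD : g.IsSkewTorsion D) {x : M}
    (u v w : TangentSpace 𝓘(ℝ, E) x) : g.torsion₃ D x u v w = g.torsion₃ D x v w u := by
  rw [hD.skew₁₂, hD.skew₂₃, neg_neg]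

theorem PseudoMetric.IsSkewTorsion.torsion₃_torsion (hD : g.IsSkewTorsion D) {x : M}
    (u v z w : TangentSpace 𝓘(ℝ, E) x) :
    g.torsion₃ D x (D.torsion x u v) z w = g.val x (D.torsion x u v) (D.torsion x z w) := by
  rw [hD.cyclic, g.symm]; rfl

theorem PseudoMetric.IsSkewTorsion.covDerivTorsion_skew₁₂ (hD : g.IsSkewTorsion D)
    (X Y Z W : VField E M) (x : M) :
    g.covDerivTorsion D X Y Z W x = -g.covDerivTorsion D X Z Y W x := by
  unfold PseudoMetric.covDerivTorsion
  rw [show (fun p => g.torsion₃ D p (Y p) (Z p) (W p)) =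
    fun p => -g.torsion₃ D p (Z p) (Y p) (W p) from funext fun p => hD.skew₁₂ _ _ _ _, dirDeriv_neg,
    hD.skew₁₂ x (D Y x (X x)), hD.skew₁₂ x (Y x), hD.skew₁₂ x (Y x)]
  ring

theorem PseudoMetric.IsSkewTorsion.covDerivTorsion_skew₂₃ (hD : g.IsSkewTorsion D)
    (X Y Z W : VField E M) (x : M) :
    g.covDerivTorsion D X Y Z W x = -g.covDerivTorsion D X Y W Z x := by
  unfold PseudoMetric.covDerivTorsion
  rw [show (fun p => g.torsion₃ D p (Y p) (Z p) (W p)) =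
    fun p => -g.torsion₃ D p (Y p) (W p) (Z p) from funext fun p => hD.skew₂₃ _ _ _ _, dirDeriv_neg,
    hD.skew₂₃ x (D Y x (X x)), hD.skew₂₃ x (Y x) (D Z x (X x)), hD.skew₂₃ x (Y x) (Z x)]
  ring

/-- The formula `dT = alternation of D T + 2 σ`, where `σ(X, Y, Z, W)` is the cyclic sum over
`X, Y, Z` of `g(T(X, Y), T(Z, W))`. -/
theorem PseudoMetric.IsSkewTorsion.extDeriv₃_eq (hD : g.IsSkewTorsion D) {X Y Z W : VField E M}
    (hX : IsSmooth X) (hY : IsSmooth Y) (hZ : IsSmooth Z) (hW : IsSmooth W) (x : M) :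
    extDeriv₃ (g.torsion₃ D) X Y Z W x =
      g.covDerivTorsion D X Y Z W x - g.covDerivTorsion D Y X Z W x
        + g.covDerivTorsion D Z X Y W x - g.covDerivTorsion D W X Y Z x
        + 2 * (g.val x (D.torsion x (X x) (Y x)) (D.torsion x (Z x) (W x))
          + g.val x (D.torsion x (Y x) (Z x)) (D.torsion x (X x) (W x))
          + g.val x (D.torsion x (Z x) (X x)) (D.torsion x (Y x) (W x))) := by
  have hsub : ∀ a b c z w : TangentSpace 𝓘(ℝ, E) x, g.torsion₃ D x (a - b - c) z w =
      g.torsion₃ D x a z w - g.torsion₃ D x b z w - g.torsion₃ D x c z w := by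
    intro a b c z w
    simp [PseudoMetric.torsion₃]
  have h1 := hD.cyclic (x := x)
  have h2 := hD.skew₁₂ x
  unfold extDeriv₃ PseudoMetric.covDerivTorsion
  simp only [mlieBracket_eq_along D, hX, hY, hZ, hW, hsub, hD.torsion₃_torsion]
  rw [h2 (D Z x (X x)), h1 (D W x (X x)), h2 (D Z x (Y x)), h2 (D Y x (Z x)), h1 (D W x (Y x)),
    h2 (D Y x (W x)), h1 (D W x (Z x)), h1 (D Z x (W x)), D.torsion_antisymm (Z x) (X x),
    g.symm x (D.torsion x (Y x) (Z x))]
  simp only [map_neg, neg_apply]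
  linear_combination g.symm x (D.torsion x (Z x) (W x)) (D.torsion x (X x) (Y x))
    - g.symm x (D.torsion x (Y x) (W x)) (D.torsion x (X x) (Z x))

variable [T2Space M]

/-- A metric connection with skew torsion is `D = ∇ + T / 2`. -/
theorem PseudoMetric.IsSkewTorsion.eq_leviCivita_add (hn : g.IsLeviCivita nabla)
    (hD : g.IsSkewTorsion D) {Y : VField E M} (hY : IsSmooth Y) (x : M)
    (v : TangentSpace 𝓘(ℝ, E) x) :
    D Y x v = nabla Y x v + (1 / 2 : ℝ) • D.torsion x v (Y x) := by
  obtain ⟨X, hX, rfl⟩ := exists_isSmooth_eq x v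
  refine g.ext_of_isSmooth fun Z hZ => ?_
  have hm : ∀ {X Y Z : VField E M}, IsSmooth Y → IsSmooth Z →
      g.val x (D Y x (X x)) (Z x) + g.val x (D Z x (X x)) (Y x) =
      g.val x (nabla Y x (X x)) (Z x) + g.val x (nabla Z x (X x)) (Y x) := by
    intro X Y Z hY hZ
    have h1 := hD.metric Y Z hY hZ x (X x)
    have h2 := hn.metric Y Z hY hZ x (X x)
    rw [g.symm x (D Z x (X x)), g.symm x (nabla Z x (X x)), ← h1, ← h2]
  have ht : ∀ {X Y Z : VField E M}, IsSmooth X → IsSmooth Y →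
      g.val x (D Y x (X x)) (Z x) - g.val x (D X x (Y x)) (Z x) =
      g.val x (nabla Y x (X x)) (Z x) - g.val x (nabla X x (Y x)) (Z x)
        + g.torsion₃ D x (X x) (Y x) (Z x) := by
    intro X Y Z hX hY
    have h1 := mlieBracket_eq_along D hX hY x
    rw [mlieBracket_eq_along nabla hX hY x, hn.torsion_eq_zero] at h1
    have h2 := congr(g.val x $h1 (Z x))
    simp only [map_sub, sub_apply, Pi.zero_apply, zero_apply, map_zero] at h2
    unfold PseudoMetric.torsion₃
    linarith
  simp only [map_add, add_apply, map_smul, smul_apply, smul_eq_mul]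
  have hc := hD.cyclic (x := x)
  change _ = _ + 1 / 2 * g.torsion₃ D x (X x) (Y x) (Z x)
  linarith [hm (X := X) hY hZ, hm (X := Y) hX hZ, hm (X := Z) hX hY, ht (Z := Z) hX hY,
    ht (Z := X) hY hZ, ht (Z := Y) hZ hX, hc (X x) (Y x) (Z x), hc (Z x) (X x) (Y x)]

/-- The curvature of `D = ∇ + T / 2` in terms of that of `∇`. -/
theorem PseudoMetric.IsSkewTorsion.curvature_eq (hn : g.IsLeviCivita nabla)
    (hD : g.IsSkewTorsion D) {X Y Z W : VField E M}
    (hX : IsSmooth X) (hY : IsSmooth Y) (hZ : IsSmooth Z) (hW : IsSmooth W) (x : M) :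
    g.val x (curvature D X Y Z x) (W x) = g.val x (curvature nabla X Y Z x) (W x)
      + (1 / 2) * (g.covDerivTorsion D X Y Z W x - g.covDerivTorsion D Y X Z W x)
      + (1 / 2) * g.val x (D.torsion x (X x) (Y x)) (D.torsion x (Z x) (W x))
      + (1 / 4) * (g.val x (D.torsion x (Y x) (Z x)) (D.torsion x (X x) (W x))
        + g.val x (D.torsion x (Z x) (X x)) (D.torsion x (Y x) (W x))) := by
  have key : ∀ {X Y : VField E M}, IsSmooth X → IsSmooth Y →
      g.val x (D (D.along Y Z) x (X x)) (W x) = g.val x (nabla (nabla.along Y Z) x (X x)) (W x)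
        + (1 / 2) * g.covDerivTorsion D X Y Z W x
        + (1 / 2) * (g.torsion₃ D x (D Y x (X x)) (Z x) (W x)
          + g.torsion₃ D x (Y x) (D Z x (X x)) (W x) + g.torsion₃ D x (X x) (D Z x (Y x)) (W x))
        + (1 / 4) * g.val x (D.torsion x (Y x) (Z x)) (D.torsion x (X x) (W x)) := by
    intro X Y hX hY
    have h1 := hD.metric _ _ (hY.along hD.smooth hZ) hW x (X x)
    have h2 := hn.metric _ _ (hY.along hn.smooth hZ) hW x (X x)
    have h3 : (fun p => g.val p (D.along Y Z p) (W p)) = fun p =>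
        g.val p (nabla.along Y Z p) (W p) + (1 / 2) * g.torsion₃ D p (Y p) (Z p) (W p) := by
      funext p
      rw [Connection.along_apply, hD.eq_leviCivita_add hn hZ]
      simp [PseudoMetric.torsion₃, Connection.along_apply]
    have ht : MDiffAt (fun p => g.torsion₃ D p (Y p) (Z p) (W p)) x :=
      g.mdifferentiableAt_apply (hY.torsionField hD.smooth hZ) hW x
    rw [h3, dirDeriv_add (g.mdifferentiableAt_apply (hY.along hn.smooth hZ) hW x)
      (h := fun p => 1 / 2 * g.torsion₃ D p (Y p) (Z p) (W p)) (ht.const_smul (1 / 2 : ℝ)),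
      dirDeriv_const_mul _ ht, h2] at h1
    simp only [Connection.along_apply] at h1
    have h4 := hD.eq_leviCivita_add hn hZ x (Y x)
    have h5 := hD.eq_leviCivita_add hn hW x (X x)
    -- Express `∇` by `D`, so that only derivatives along `D` remain besides the curvature terms.
    rw [← sub_eq_iff_eq_add] at h4 h5
    rw [← h4, ← h5] at h1
    simp only [map_sub, sub_apply, map_smul, smul_apply, smul_eq_mul] at h1
    have h6 := hD.cyclic (X x) (W x) (D Z x (Y x))
    have h7 := hD.skew₂₃ x (X x) (W x) (D Z x (Y x))
    have h8 := g.symm x (D Z x (Y x)) (D.torsion x (X x) (W x))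
    unfold PseudoMetric.covDerivTorsion
    unfold PseudoMetric.torsion₃ at *
    linarith
  have hb := hD.eq_leviCivita_add hn hZ x (VectorField.mlieBracket 𝓘(ℝ, E) X Y x)
  have hb' := congr(g.val x $hb (W x))
  have hb'' := congr(g.torsion₃ D x $(mlieBracket_eq_along D hX hY x) (Z x) (W x))
  have ht := hD.torsion₃_torsion (X x) (Y x) (Z x) (W x)
  simp only [curvature_apply, map_sub, sub_apply, key hX hY, key hY hX]
  unfold PseudoMetric.torsion₃ at *
  rw [D.torsion_antisymm (Z x) (X x)]
  simp only [map_add, map_sub, map_neg, add_apply, sub_apply, neg_apply, map_smul, smul_apply,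
    smul_eq_mul] at hb' hb'' ht ⊢
  linarith

end

/-! ### Traces of forms that are anti-invariant under an isometry -/

section Trace

/-- The trace, with respect to `b`, of a form `β` that changes sign under a `b`-isometry `I` with
`I² = -1` is zero. Nondegeneracy of `b` is not needed: otherwise the inverse matrix is zero by
convention. -/
theorem sum_inv_mul_eq_zero {F ι : Type*} [AddCommGroup F] [Module ℝ F] [Fintype ι]
    [DecidableEq ι] (e : Module.Basis ι ℝ F) (I : F →ₗ[ℝ] F) (hI : ∀ v, I (I v) = -v)
    (b β : F →ₗ[ℝ] F →ₗ[ℝ] ℝ) (hb : ∀ v w, b (I v) (I w) = b v w)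
    (hβ : ∀ v w, β (I v) (I w) = -β v w) :
    ∑ i, ∑ j, (Matrix.of fun i j => b (e i) (e j))⁻¹ i j * β (e i) (e j) = 0 := by
  set P := LinearMap.toMatrix e e I
  have hP : P * P = -1 := by
    rw [← LinearMap.toMatrix_comp e e e, ← LinearMap.toMatrix_id e, ← map_neg]
    congr 1
    ext v
    simp [hI]
  have hPT : P.transpose * P.transpose = -1 := by
    rw [← Matrix.transpose_mul, hP, Matrix.transpose_neg, Matrix.transpose_one]
  have hconj : ∀ c : F →ₗ[ℝ] F →ₗ[ℝ] ℝ, P.transpose * (Matrix.of fun i j => c (e i) (e j)) * P =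
      Matrix.of fun i j => c (I (e i)) (I (e j)) := by
    intro c
    have := LinearMap.toMatrix₂_compl₁₂ e e e e c I I
    have hc : ∀ d : F →ₗ[ℝ] F →ₗ[ℝ] ℝ,
        LinearMap.toMatrix₂ e e d = Matrix.of fun i j => d (e i) (e j) := by
      intro d
      ext i j
      rw [Matrix.of_apply, LinearMap.toMatrix₂_apply]
    rw [hc, hc] at this
    exact this.symm
  have hG := hconj b
  have hB := hconj β
  simp only [hb] at hG
  simp only [hβ] at hB
  set G : Matrix ι ι ℝ := Matrix.of fun i j => b (e i) (e j) with hGdef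
  set B : Matrix ι ι ℝ := Matrix.of fun i j => β (e i) (e j) with hBdef
  have hPi : P⁻¹ = -P := Matrix.inv_eq_right_inv (by rw [mul_neg, hP, neg_neg])
  have hPTi : P.transpose⁻¹ = -P.transpose :=
    Matrix.inv_eq_right_inv (by rw [mul_neg, hPT, neg_neg])
  -- `mul_inv_rev` and hence this invariance of `G⁻¹` hold even if `G` is singular.
  have hGi : G⁻¹ = P * G⁻¹ * P.transpose := by
    conv_lhs => rw [← hG, Matrix.mul_inv_rev, Matrix.mul_inv_rev, hPi, hPTi]
    simp [mul_assoc]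
  have hB' : P.transpose * B * P = -B := by
    rw [hB]; ext; simp [hBdef]
  have htr : (G⁻¹ * B.transpose).trace = -(G⁻¹ * B.transpose).trace := by
    conv_lhs => rw [hGi, mul_assoc, mul_assoc, Matrix.trace_mul_comm]
    have := congr(G⁻¹ * ($hB').transpose)
    rw [Matrix.transpose_mul, Matrix.transpose_mul, Matrix.transpose_transpose] at this
    simp only [← mul_assoc] at this ⊢
    rw [this]
    simp
  have h0 : (G⁻¹ * B.transpose).trace = 0 := by linarith
  simpa [Matrix.trace, Matrix.mul_apply, hBdef] using h0

end Trace

/-! ### The torsion of a pHKT-connection -/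

section

variable {E : Type*} [NormedAddCommGroup E] [NormedSpace ℝ E]
  {M : Type*} [TopologicalSpace M] [ChartedSpace E M] [IsManifold 𝓘(ℝ, E) ∞ M]

theorem AlmostHGStructure.g_J_left (S : AlmostHGStructure E M) (α : Fin 3) (x : M)
    (v w : TangentSpace 𝓘(ℝ, E) x) :
    S.g.val x ((S.J α).val x v) w = -eps α * S.g.val x v ((S.J α).val x w) := by
  rw [S.compat α x v ((S.J α).val x w), S.J_sq, map_neg]
  have : eps α * eps α = 1 := by unfold eps; split_ifs <;> norm_num
  linear_combination (-1 * S.g.val x ((S.J α).val x v) w) * this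

variable [CompleteSpace E] [FiniteDimensional ℝ E]
  {S : AlmostHGStructure E M} {D nabla : Connection E M}

theorem AlmostHGStructure.IsPHKT.isSkewTorsion (hD : S.IsPHKT D) : S.g.IsSkewTorsion D :=
  ⟨hD.smooth, hD.metric, hD.skew₁₂, hD.skew₂₃⟩

theorem AlmostHGStructure.IsPHKT.apply_J (hD : S.IsPHKT D) (α : Fin 3) {Z : VField E M}
    (hZ : IsSmooth Z) (x : M) (v : TangentSpace 𝓘(ℝ, E) x) :
    D (fun p => (S.J α).val p (Z p)) x v = (S.J α).val x (D Z x v) := by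
  have := hD.parallel α x v (Z x)
  rwa [EndField.covDeriv_apply _ _ _ _ (hZ.mdifferentiableAt x), sub_eq_zero] at this

variable [T2Space M]

theorem AlmostHGStructure.IsPHKT.covDeriv_eq (hn : S.g.IsLeviCivita nabla) (hD : S.IsPHKT D)
    (α : Fin 3) (x : M) (v w : TangentSpace 𝓘(ℝ, E) x) :
    (S.J α).covDeriv nabla x v w = (1 / 2 : ℝ) •
      ((S.J α).val x (D.torsion x v w) - D.torsion x v ((S.J α).val x w)) := by
  obtain ⟨W, hW, rfl⟩ := exists_isSmooth_eq x w
  have h := hD.apply_J α hW x v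
  rw [hD.isSkewTorsion.eq_leviCivita_add hn hW,
    hD.isSkewTorsion.eq_leviCivita_add hn ((S.J α).isSmooth_apply hW), map_add, map_smul] at h
  rw [EndField.covDeriv_apply _ _ _ _ (hW.mdifferentiableAt x)]
  linear_combination (norm := module) (1 : ℝ) • h

/-- In the nearly Kähler class, `J₁` can be moved between the arguments of the torsion of `D`: the
torsion has type (3,0)+(0,3) with respect to `J₁`. -/
theorem AlmostHGStructure.IsPHKT.torsion_J_right (hn : S.g.IsLeviCivita nabla) (hD : S.IsPHKT D)
    (hS : S.IsW133 nabla) (x : M) (u v : TangentSpace 𝓘(ℝ, E) x) :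
    D.torsion x u ((S.J 0).val x v) = D.torsion x ((S.J 0).val x u) v := by
  refine sub_eq_zero.1 (S.g.nondegenerate x _ fun w => ?_)
  have h := hS.nearlyKahler x u v w
  simp only [AlmostHGStructure.F, hD.covDeriv_eq hn] at h
  rw [D.torsion_antisymm v u, D.torsion_antisymm v] at h
  simp only [map_smul, map_sub, map_neg, sub_apply, neg_apply, smul_apply, smul_eq_mul] at h ⊢
  linarith

theorem AlmostHGStructure.IsPHKT.torsion_J (hn : S.g.IsLeviCivita nabla) (hD : S.IsPHKT D)
    (hS : S.IsW133 nabla) (x : M) (u v : TangentSpace 𝓘(ℝ, E) x) :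
    D.torsion x ((S.J 0).val x u) v = -(S.J 0).val x (D.torsion x u v) := by
  refine sub_eq_zero.1 (S.g.nondegenerate x _ fun w => ?_)
  have h1 := hD.isSkewTorsion.cyclic u ((S.J 0).val x v) w
  have h2 := hD.isSkewTorsion.cyclic u v ((S.J 0).val x w)
  have h3 := S.g_J_left 0 x (D.torsion x u v) w
  unfold PseudoMetric.torsion₃ at h1 h2
  rw [hD.torsion_J_right hn hS] at h1 h2
  simp only [eps, if_true] at h3
  simp only [map_sub, map_neg, sub_apply, neg_apply]
  linarith

end

/-! ### Isotropy and flatness -/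

section

variable {E : Type*} [NormedAddCommGroup E] [NormedSpace ℝ E]
  {M : Type*} [TopologicalSpace M] [ChartedSpace E M] [IsManifold 𝓘(ℝ, E) ∞ M]

theorem AlmostHGStructure.J_anticomm (S : AlmostHGStructure E M) {α : Fin 3} (hα : α ≠ 0) (x : M)
    (v : TangentSpace 𝓘(ℝ, E) x) :
    (S.J α).val x ((S.J 0).val x v) = -(S.J 0).val x ((S.J α).val x v) := by
  fin_cases α
  · exact absurd rfl hα
  · have h1 := S.J_eq 2 x v
    have h2 := S.J_eq_neg 2 x v
    exact (neg_eq_iff_eq_neg.2 (h1.symm.trans h2)).symm ▸ rfl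
  · exact (S.J_eq 1 x v).symm.trans (S.J_eq_neg 1 x v)

/-- The square norm of `(v, w) ↦ B w v` vanishes if the form `g(B w ·, B w' ·)` changes sign under the
isometry `J₁`, for all `w`, `w'`. -/
theorem AlmostHGStructure.sqNorm_eq_zero (S : AlmostHGStructure E M) {x : M} {ι : Type*} [Fintype ι]
    [DecidableEq ι] (e : Module.Basis ι ℝ (TangentSpace 𝓘(ℝ, E) x))
    (B : TangentSpace 𝓘(ℝ, E) x → TangentSpace 𝓘(ℝ, E) x →L[ℝ] TangentSpace 𝓘(ℝ, E) x)
    (hB : ∀ u u' w w', S.g.val x (B w ((S.J 0).val x u)) (B w' ((S.J 0).val x u')) =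
      -S.g.val x (B w u) (B w' u')) :
    S.g.sqNorm e (fun v w => B w v) = 0 := by
  have h : ∀ w w', ∑ i, ∑ j, (Matrix.of fun i j => S.g.val x (e i) (e j))⁻¹ i j *
      S.g.val x (B w (e i)) (B w' (e j)) = 0 := by
    intro w w'
    refine sum_inv_mul_eq_zero e ((S.J 0).val x).toLinearMap (S.J_sq 0 x)
      (LinearMap.mk₂ ℝ (fun u v => S.g.val x u v) (by simp) (by simp) (by simp) (by simp))
      (LinearMap.mk₂ ℝ (fun u v => S.g.val x (B w u) (B w' v)) (by simp) (by simp) (by simp)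
        (by simp)) (fun u v => ?_) (fun u v => hB u v w w')
    have := S.compat 0 x u v
    simp only [eps, if_true, one_mul] at this
    exact this.symm
  unfold PseudoMetric.sqNorm
  have : ∀ i j, ∑ k, ∑ s, (Matrix.of fun i j => S.g.val x (e i) (e j))⁻¹ i j *
      (Matrix.of fun i j => S.g.val x (e i) (e j))⁻¹ k s *
      S.g.val x (B (e k) (e i)) (B (e s) (e j)) = ∑ p : ι × ι,
      (Matrix.of fun i j => S.g.val x (e i) (e j))⁻¹ p.1 p.2 *
      ((Matrix.of fun i j => S.g.val x (e i) (e j))⁻¹ i j *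
      S.g.val x (B (e p.1) (e i)) (B (e p.2) (e j))) := by
    intro i j
    rw [Fintype.sum_prod_type]
    exact Finset.sum_congr rfl fun k _ => Finset.sum_congr rfl fun s _ => by ring
  simp only [this]
  rw [Finset.sum_congr rfl fun i _ => Finset.sum_comm, Finset.sum_comm]
  refine Finset.sum_eq_zero fun p _ => ?_
  simp only [← Finset.mul_sum, h, mul_zero]

variable [CompleteSpace E] [FiniteDimensional ℝ E]
  {S : AlmostHGStructure E M} {D nabla : Connection E M}

theorem AlmostHGStructure.IsPHKT.covDerivTorsion_J_J (hD : S.IsPHKT D) (X Z W : VField E M)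
    {Y : VField E M} (hY : IsSmooth Y) (x : M) :
    S.g.covDerivTorsion D X (fun p => (S.J 0).val p ((S.J 0).val p (Y p))) Z W x =
      -S.g.covDerivTorsion D X Y Z W x := by
  have h : ∀ (p : M) (u v w : TangentSpace 𝓘(ℝ, E) p),
      S.g.torsion₃ D p (-u) v w = -S.g.torsion₃ D p u v w := by
    intro p u v w
    simp [PseudoMetric.torsion₃]
  unfold PseudoMetric.covDerivTorsion
  rw [hD.apply_J 0 ((S.J 0).isSmooth_apply hY), hD.apply_J 0 hY]
  simp only [S.J_sq, h, dirDeriv_neg]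
  ring

variable [T2Space M]

theorem AlmostHGStructure.IsPHKT.isIsotropicHyperKahler (hn : S.g.IsLeviCivita nabla)
    (hD : S.IsPHKT D) (hS : S.IsW133 nabla)
    (hq : ∀ (x : M) (u v z w : TangentSpace 𝓘(ℝ, E) x),
      S.g.val x (D.torsion x u v) (D.torsion x z w) = 0) : S.IsIsotropicHyperKahler nabla := by
  have hqJ : ∀ (α : Fin 3) (x : M) (u v z w : TangentSpace 𝓘(ℝ, E) x),
      S.g.val x ((S.J α).val x (D.torsion x u v)) ((S.J α).val x (D.torsion x z w)) = 0 := by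
    intro α x u v z w
    have h := S.compat α x (D.torsion x u v) (D.torsion x z w)
    rw [hq, eq_comm, mul_eq_zero] at h
    refine h.resolve_left ?_
    unfold eps; split_ifs <;> norm_num
  intro α x e
  by_cases hα : α = 0
  · subst hα
    have h : ∀ u v, (S.J 0).covDeriv nabla x u v = -D.torsion x u ((S.J 0).val x v) := by
      intro u v
      rw [hD.covDeriv_eq hn, hD.torsion_J_right hn hS, hD.torsion_J hn hS]
      module
    simp [PseudoMetric.sqNorm, h, hq]
  · refine S.sqNorm_eq_zero e
      (fun w => TensorialAt.mkHom _ x ((S.J α).tensorialAt_covDeriv nabla x) w) ?_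
    intro u u' w w'
    change S.g.val x ((S.J α).covDeriv nabla x _ _) ((S.J α).covDeriv nabla x _ _) =
      -S.g.val x ((S.J α).covDeriv nabla x _ _) ((S.J α).covDeriv nabla x _ _)
    -- `J_α` anticommutes with `J₁`, so the relative sign of the two terms of `∇ J_α` is reversed.
    have hI : ∀ u w, (S.J α).covDeriv nabla x ((S.J 0).val x u) w = (S.J 0).val x ((1 / 2 : ℝ) •
        ((S.J α).val x (D.torsion x u w) + D.torsion x u ((S.J α).val x w))) := by
      intro u w
      rw [hD.covDeriv_eq hn, hD.torsion_J hn hS, hD.torsion_J hn hS, map_neg, S.J_anticomm hα,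
        map_smul, map_add]
      module
    have h0 := S.compat 0 x
    simp only [eps, if_true, one_mul] at h0
    rw [hI, hI, ← h0, hD.covDeriv_eq hn, hD.covDeriv_eq hn]
    simp only [map_smul, map_sub, map_add, smul_apply, sub_apply, add_apply, smul_eq_mul, hq, hqJ]
    ring

theorem AlmostHGStructure.IsPHKT.covDerivTorsion_J (hn : S.g.IsLeviCivita nabla)
    (hD : S.IsPHKT D) (hS : S.IsW133 nabla) (X : VField E M) {Y Z : VField E M} (W : VField E M)
    (hY : IsSmooth Y) (hZ : IsSmooth Z) (x : M) :
    S.g.covDerivTorsion D X (fun p => (S.J 0).val p (Y p)) Z W x =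
      S.g.covDerivTorsion D X Y (fun p => (S.J 0).val p (Z p)) W x := by
  have h : ∀ (p : M) (u v w : TangentSpace 𝓘(ℝ, E) p),
      S.g.torsion₃ D p ((S.J 0).val p u) v w = S.g.torsion₃ D p u ((S.J 0).val p v) w := by
    intro p u v w
    unfold PseudoMetric.torsion₃
    rw [hD.torsion_J_right hn hS]
  unfold PseudoMetric.covDerivTorsion
  rw [hD.apply_J 0 hY, hD.apply_J 0 hZ]
  simp only [h]

/-- The image of the torsion is totally null as soon as the alternation of `D T` is a nonzero multiple
of the cyclic sum of `g(T(X, Y), T(Z, W))`. Both flatness and strongness of `D` provide this, with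
different multiples. -/
theorem AlmostHGStructure.IsPHKT.torsion_null (hn : S.g.IsLeviCivita nabla)
    (hD : S.IsPHKT D) (hS : S.IsW133 nabla) {κ : ℝ} (hκ : κ ≠ 0) (x : M)
    (hs : ∀ X Y Z W : VField E M, IsSmooth X → IsSmooth Y → IsSmooth Z → IsSmooth W →
      S.g.covDerivTorsion D X Y Z W x - S.g.covDerivTorsion D Y X Z W x
        + S.g.covDerivTorsion D Z X Y W x - S.g.covDerivTorsion D W X Y Z x =
      κ * (S.g.val x (D.torsion x (X x) (Y x)) (D.torsion x (Z x) (W x))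
          + S.g.val x (D.torsion x (Y x) (Z x)) (D.torsion x (X x) (W x))
          + S.g.val x (D.torsion x (Z x) (X x)) (D.torsion x (Y x) (W x))))
    (u v z w : TangentSpace 𝓘(ℝ, E) x) :
    S.g.val x (D.torsion x u v) (D.torsion x z w) = 0 := by
  obtain ⟨X, hX, rfl⟩ := exists_isSmooth_eq x u
  obtain ⟨Y, hY, rfl⟩ := exists_isSmooth_eq x v
  obtain ⟨Z, hZ, rfl⟩ := exists_isSmooth_eq x z
  obtain ⟨W, hW, rfl⟩ := exists_isSmooth_eq x w
  have h0 := S.compat 0 x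
  simp only [eps, if_true, one_mul] at h0
  let I : {X : VField E M // IsSmooth X} → {X : VField E M // IsSmooth X} :=
    fun X => ⟨fun p => (S.J 0).val p (X.1 p), (S.J 0).isSmooth_apply X.2⟩
  refine eq_zero_of_alternation (V := {X : VField E M // IsSmooth X}) (I := I) hκ
    (A := fun X Y Z W => S.g.covDerivTorsion D X.1 Y.1 Z.1 W.1 x)
    (q := fun X Y Z W => S.g.val x (D.torsion x (X.1 x) (Y.1 x)) (D.torsion x (Z.1 x) (W.1 x)))
    (fun X Y Z W => hD.isSkewTorsion.covDerivTorsion_skew₁₂ _ _ _ _ _)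
    (fun X Y Z W => hD.isSkewTorsion.covDerivTorsion_skew₂₃ _ _ _ _ _)
    (fun X Y Z W => hD.covDerivTorsion_J hn hS _ _ Y.2 Z.2 x)
    (fun X Y Z W => hD.covDerivTorsion_J_J _ _ _ Y.2 x)
    (fun X Y Z W => by rw [D.torsion_antisymm, map_neg, neg_apply])
    (fun X Y Z W => S.g.symm x _ _)
    (fun X Y Z W => by dsimp only [I]; rw [hD.torsion_J_right hn hS])
    (fun X Y Z W => by simp [I, S.J_sq])
    (fun X Y Z W => by
      dsimp only [I]
      rw [hD.torsion_J_right hn hS, hD.torsion_J_right hn hS, hD.torsion_J hn hS,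
        hD.torsion_J hn hS, map_neg, map_neg, neg_apply, neg_neg, ← h0])
    (fun X Y Z W => hs _ _ _ _ X.2 Y.2 Z.2 W.2) ⟨X, hX⟩ ⟨Y, hY⟩ ⟨Z, hZ⟩ ⟨W, hW⟩

/-- A strong pHKT-connection with totally null torsion has the same curvature as `∇`, which then is
Kähler for all three structures and hence zero. -/
theorem AlmostHGStructure.IsPHKT.isFlat_leviCivita (hn : S.g.IsLeviCivita nabla)
    (hD : S.IsPHKT D) (hS : S.IsW133 nabla)
    (hq : ∀ (x : M) (u v z w : TangentSpace 𝓘(ℝ, E) x),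
      S.g.val x (D.torsion x u v) (D.torsion x z w) = 0)
    (hs : S.g.IsStrong D) : IsFlat nabla := by
  intro X Y Z hX hY hZ p
  let V := {X : VField E M // IsSmooth X}
  let J : Fin 3 → V → V :=
    fun α X => ⟨fun p => (S.J α).val p (X.1 p), (S.J α).isSmooth_apply X.2⟩
  let A : V → V → V → V → ℝ := fun X Y Z W => S.g.covDerivTorsion D X.1 Y.1 Z.1 W.1 p
  let R : V → V → V → V → ℝ := fun X Y Z W => S.g.val p (curvature nabla X.1 Y.1 Z.1 p) (W.1 p)
  let RD : V → V → V → V → ℝ := fun X Y Z W => S.g.val p (curvature D X.1 Y.1 Z.1 p) (W.1 p)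
  have hA₂₃ : ∀ x y z w, A x y z w = -A x z y w :=
    fun X Y Z W => hD.isSkewTorsion.covDerivTorsion_skew₁₂ _ _ _ _ _
  have hA₃₄ : ∀ x y z w, A x y z w = -A x y w z :=
    fun X Y Z W => hD.isSkewTorsion.covDerivTorsion_skew₂₃ _ _ _ _ _
  have hAI : ∀ x y z w, A x (J 0 y) z w = A x y (J 0 z) w :=
    fun X Y Z W => hD.covDerivTorsion_J hn hS _ _ Y.2 Z.2 p
  have hAII : ∀ x y z w, A x (J 0 (J 0 y)) z w = -A x y z w :=
    fun X Y Z W => hD.covDerivTorsion_J_J _ _ _ Y.2 p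
  have hAs : ∀ x y z w, A x y z w - A y x z w + A z x y w - A w x y z = 0 := by
    intro X Y Z W
    have h := hs _ _ _ _ X.2 Y.2 Z.2 W.2 p
    rw [hD.isSkewTorsion.extDeriv₃_eq X.2 Y.2 Z.2 W.2, hq, hq, hq] at h
    linarith
  obtain ⟨-, hA₃₄', -⟩ := pure_form_comp hA₂₃ hA₃₄ hAI hAII
  have hAt := pure_form_of_alternation_eq_zero hA₂₃ hA₃₄ hAI hAII hAs
  have hRD : ∀ x y z w, RD x y z w = R x y z w + (1 / 2) * (A x y z w - A y x z w) := by
    intro X Y Z W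
    have h := hD.isSkewTorsion.curvature_eq hn X.2 Y.2 Z.2 W.2 p
    rw [hq, hq, hq] at h
    linarith
  have hRDJ : ∀ α x y z w, RD x y (J α z) w = -eps α * RD x y z (J α w) := by
    intro α X Y Z W
    dsimp only [RD, J]
    rw [curvature_endField (S.J α) (fun Z hZ p v => hD.apply_J α hZ p v) hD.smooth X.2 Y.2 Z.2,
      S.g_J_left]
  have hR₁₂ : ∀ x y z w, R x y z w = -R y x z w := by
    intro X Y Z W
    dsimp only [R]
    rw [curvature_swap, map_neg, neg_apply]
  have hR₃₄ : ∀ x y z w, R x y z w = -R x y w z := by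
    intro X Y Z W
    exact curvature_skew S.g hn.smooth hn.metric X.2 Y.2 Z.2 W.2 p
  have hRB : ∀ x y z w, R x y z w + R y z x w + R z x y w = 0 := by
    intro X Y Z W
    have h := congr(S.g.val p $(curvature_bianchi hn.smooth hn.torsion_eq_zero X.2 Y.2 Z.2 p)
      (W.1 p))
    simpa using h
  have hRJJ : ∀ α x y z w, R x y z (J α (J α w)) = -R x y z w := by
    intro α X Y Z W
    simp [R, J, S.J_sq]
  -- `J₁`-invariance of the curvature of `D` controls the failure of `J₁`-invariance of that of `∇`.
  have hP : ∀ x y z w, A x y z w - A y x z w = 0 := by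
    refine eq_zero_of_kaehler_exchange (R := R) (I := J 0)
      (pair_symm_of_bianchi hR₁₂ hR₃₄ hRB) ?_ ?_ ?_
    · intro x y z w
      have h := hRDJ 0 x y z (J 0 w)
      have h₄ : ∀ x y, A x y z (J 0 (J 0 w)) = -A x y z w := fun x y => by
        rw [hA₃₄, hA₂₃, hAII]; linarith [hA₂₃ x w y z, hA₃₄ x y z w]
      rw [hRD, hRD, hRJJ, hA₃₄', hA₃₄', h₄, h₄] at h
      simp only [eps, if_true] at h
      linarith
    · intro x y z w
      linarith [hAs x y z w, hA₂₃ z w x y, hA₃₄ z x w y, hA₂₃ w z x y, hA₃₄ w x z y]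
    · intro x y z w
      rw [hAt, hAt]; ring
  have hRR : ∀ x y z w, RD x y z w = R x y z w := fun x y z w => by rw [hRD, hP]; ring
  have hJ1 := hRDJ 1
  have hJ2 := hRDJ 2
  simp only [hRR, eps] at hJ1 hJ2
  have hzero : ∀ x y z w, R x y z w = 0 := by
    intro x y z w
    have h := comp_eq_zero_of_norden_kaehler hR₁₂ hR₃₄ hRB (J := J 1) (K := J 2)
      (by simpa using hJ1) (by simpa using hJ2) (fun X Y Z W => ?_) x y z (J 0 w)
    · have h01 : J 1 (J 2 (J 0 w)) = J 0 (J 0 w) := Subtype.ext (funext fun p =>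
        (S.J_eq 0 p _).symm)
      rw [h01, hRJJ] at h
      linarith
    · have h1 := S.J_eq 0 p (W.1 p)
      have h2 := S.J_eq_neg 0 p (W.1 p)
      have h3 : (S.J 1).val p ((S.J 2).val p (W.1 p)) = -(S.J 2).val p ((S.J 1).val p (W.1 p)) :=
        h1.symm.trans h2
      dsimp only [R, J]
      rw [h3, map_neg]
  refine S.g.ext_of_isSmooth fun W hW => ?_
  rw [map_zero, zero_apply]
  exact hzero ⟨X, hX⟩ ⟨Y, hY⟩ ⟨Z, hZ⟩ ⟨W, hW⟩

/-- For flat `D`, the Bianchi identity of `∇` gives the cyclic sums of `D T`; the alternation follows by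
adding these up over the choices of three of the four arguments. -/
theorem PseudoMetric.IsSkewTorsion.covDerivTorsion_alternation_of_isFlat {g : PseudoMetric E M}
    (hn : g.IsLeviCivita nabla) (hD : g.IsSkewTorsion D) (hf : IsFlat D) {X Y Z W : VField E M}
    (hX : IsSmooth X) (hY : IsSmooth Y) (hZ : IsSmooth Z) (hW : IsSmooth W) (x : M) :
    g.covDerivTorsion D X Y Z W x - g.covDerivTorsion D Y X Z W x
        + g.covDerivTorsion D Z X Y W x - g.covDerivTorsion D W X Y Z x =
      -(4 / 3) * (g.val x (D.torsion x (X x) (Y x)) (D.torsion x (Z x) (W x))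
          + g.val x (D.torsion x (Y x) (Z x)) (D.torsion x (X x) (W x))
          + g.val x (D.torsion x (Z x) (X x)) (D.torsion x (Y x) (W x))) := by
  have key : ∀ {X Y Z W : VField E M}, IsSmooth X → IsSmooth Y → IsSmooth Z → IsSmooth W →
      g.covDerivTorsion D X Y Z W x + g.covDerivTorsion D Y Z X W x
        + g.covDerivTorsion D Z X Y W x =
      -(g.val x (D.torsion x (X x) (Y x)) (D.torsion x (Z x) (W x))
          + g.val x (D.torsion x (Y x) (Z x)) (D.torsion x (X x) (W x))
          + g.val x (D.torsion x (Z x) (X x)) (D.torsion x (Y x) (W x))) := by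
    intro X Y Z W hX hY hZ hW
    have h1 := hD.curvature_eq hn hX hY hZ hW x
    have h2 := hD.curvature_eq hn hY hZ hX hW x
    have h3 := hD.curvature_eq hn hZ hX hY hW x
    rw [hf _ _ _ hX hY hZ] at h1
    rw [hf _ _ _ hY hZ hX] at h2
    rw [hf _ _ _ hZ hX hY] at h3
    have h4 := congr(g.val x $(curvature_bianchi hn.smooth hn.torsion_eq_zero hX hY hZ x) (W x))
    simp only [map_zero, zero_apply, map_add, add_apply] at h1 h2 h3 h4
    linarith [hD.covDerivTorsion_skew₁₂ X Y Z W x, hD.covDerivTorsion_skew₁₂ Y Z X W x,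
      hD.covDerivTorsion_skew₁₂ Z X Y W x]
  have hs := hD.covDerivTorsion_skew₁₂ (x := x)
  have hs' := hD.covDerivTorsion_skew₂₃ (x := x)
  have hc : ∀ X Y Z W, g.covDerivTorsion D X Y Z W x = g.covDerivTorsion D X Z W Y x := by
    intro X Y Z W
    rw [hs, hs', neg_neg]
  -- The combination `k1 - k2 + k3 - k4` is three times the alternation.
  have k1 := key hX hY hZ hW
  have k2 := key hX hY hW hZ
  have k3 := key hX hZ hW hY
  have k4 := key hY hZ hW hX
  rw [D.torsion_antisymm (Z x) (X x)] at k1 ⊢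
  rw [D.torsion_antisymm (W x) (Z x), D.torsion_antisymm (W x) (X x)] at k2
  rw [D.torsion_antisymm (W x) (Y x), D.torsion_antisymm (W x) (X x),
    D.torsion_antisymm (Z x) (Y x)] at k3
  rw [D.torsion_antisymm (W x) (X x), D.torsion_antisymm (Y x) (X x),
    D.torsion_antisymm (W x) (Y x), D.torsion_antisymm (Z x) (X x)] at k4
  simp only [map_neg, neg_apply, neg_neg] at k1 k2 k3 k4 ⊢
  have s1 := g.symm x (D.torsion x (X x) (Y x)) (D.torsion x (Z x) (W x))
  have s2 := g.symm x (D.torsion x (X x) (Z x)) (D.torsion x (Y x) (W x))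
  have s3 := g.symm x (D.torsion x (X x) (W x)) (D.torsion x (Y x) (Z x))
  linarith [hs Y Z X W, hs' X Y Z W, hc Y W X Z, hc X Y Z W, hc Z W X Y, hs' W X Y Z, hc Y X Z W,
    hs Z W Y X, hc Z X Y W, hc W X Y Z]

end

end PHKT

end

theorem theorem19 {n : ℕ} {M : Type*} [TopologicalSpace M] [T2Space M]
    [ChartedSpace (EuclideanSpace ℝ (Fin (4 * n))) M] [IsManifold (𝓡 (4 * n)) ∞ M]
    (S : PHKT.AlmostHGStructure (EuclideanSpace ℝ (Fin (4 * n))) M)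
    (nabla D : PHKT.Connection (EuclideanSpace ℝ (Fin (4 * n))) M)
    (hnabla : S.g.IsLeviCivita nabla) (hS : S.IsW133 nabla) (hD : S.IsPHKT D)
    (h : PHKT.IsFlat D ∨ S.g.IsStrong D) :
    PHKT.IsFlat nabla ∧ S.IsIsotropicHyperKahler nabla ∧ S.g.HasIsotropicTorsion D := by
  have hT := hD.isSkewTorsion
  have hq : ∀ x u v z w, S.g.val x (D.torsion x u v) (D.torsion x z w) = 0 := by
    intro x
    rcases h with hf | hs
    · exact hD.torsion_null hnabla hS (κ := -(4 / 3)) (by norm_num) x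
        fun X Y Z W hX hY hZ hW =>
          hT.covDerivTorsion_alternation_of_isFlat hnabla hf hX hY hZ hW x
    · refine hD.torsion_null hnabla hS (κ := -2) (by norm_num) x fun X Y Z W hX hY hZ hW => ?_
      have h := hs X Y Z W hX hY hZ hW x
      rw [hT.extDeriv₃_eq hX hY hZ hW] at h
      linarith
  have hs : S.g.IsStrong D := by
    rcases h with hf | hs
    · intro X Y Z W hX hY hZ hW x
      rw [hT.extDeriv₃_eq hX hY hZ hW,
        hT.covDerivTorsion_alternation_of_isFlat hnabla hf hX hY hZ hW, hq, hq, hq]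
      ring
    · exact hs
  refine ⟨hD.isFlat_leviCivita hnabla hS hq hs, hD.isIsotropicHyperKahler hnabla hS hq, ?_⟩
  intro x e
  simp [PHKT.PseudoMetric.sqNorm, hq]
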